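/- Let $M_n$ denote the space of complex $n\times n$ matrices. For $Z\in M_n$ let $|Z|=(Z^*Z)^{1/2}$ and let $|Z|_{\mathrm{sym}}=\tfrac12\bigl(|Z|+|Z^*|\bigr)$ be its arithmetic symmetric modulus. A norm $\|\cdot\|$ on $M_n$ is called unitarily invariant if $\|UZV\|=\|Z\|$ for all $Z\in M_n$ and all unitary $U,V\in M_n$. For all $m,n$, all $A_1,\dots,A_m\in M_n$ and every unitarily invariant norm $\|\cdot\|$ on $M_n$, $$\Bigl\|\sum_{k=1}^m A_k\Bigr\|\ \le\ 2\,\Bigl\|\sum_{k=1}^m |A_k|_{\mathrm{sym}}\Bigr\|.$$ Moreover, the constant $2$ is sharp: for every $m\ge 1$ and $n\ge 2$, $2$ is the smallest real number $C$ such that $\|\sum_{k} A_k\|\le C\,\|\sum_{k}|A_k|_{\mathrm{sym}}\|$ holds for every unitarily invariant norm on $M_n$ and all $A_1,\dots,A_m\in M_n$. Indeed, when $\|\cdot\|$ is the operator norm (induced by the Euclidean norm of $\mathbb C^n$) and $A_1=\dots=A_m=E_{12}$, the matrix unit with entry $1$ in position $(1,2)$ and $0$ elsewhere, equality holds and both sides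 are positive. -/

import Mathlib

open scoped Matrix MatrixOrder

noncomputable section

/-- The arithmetic symmetric modulus `(|Z| + |Zᴴ|) / 2`, where `|Z| = (Zᴴ Z)^{1/2}` is
`CFC.abs Z` (the positive semidefinite square root of `Zᴴ * Z`). -/
def symModulus {n : ℕ} (Z : Matrix (Fin n) (Fin n) ℂ) : Matrix (Fin n) (Fin n) ℂ :=
  (1 / 2 : ℝ) • (CFC.abs Z + CFC.abs Zᴴ)

/-- `N` is a norm on the `n × n` complex matrices (an absolutely homogeneous subadditive function
that vanishes only at `0`) with `N (U Z V) = N Z` for all unitary `U` and `V`. -/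
structure IsUnitarilyInvariantNorm {n : ℕ} (N : Seminorm ℂ (Matrix (Fin n) (Fin n) ℂ)) :
    Prop where
  eq_zero_of_apply_eq_zero : ∀ Z, N Z = 0 → Z = 0
  unitary_mul_mul_unitary : ∀ U ∈ Matrix.unitaryGroup (Fin n) ℂ,
    ∀ V ∈ Matrix.unitaryGroup (Fin n) ℂ, ∀ Z, N (U * Z * V) = N Z

/-- The operator norm of a matrix, acting on `ℂⁿ` with its Euclidean norm. -/
def matrixOpNorm {n : ℕ} (Z : Matrix (Fin n) (Fin n) ℂ) : ℝ :=
  ‖Matrix.toEuclideanCLM (n := Fin n) (𝕜 := ℂ) Z‖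

end

/-! The proof is by duality. A norming functional of `∑ k, A k` has the form `Z ↦ tr (B * Z)` and is
dominated by `N`. Writing `B = W * |B|` with `W` unitary, one has `|B| = Wᴴ * B` and `|Bᴴ| = B *
Wᴴ`, so unitary invariance bounds the pairings of `S = ∑ k, symModulus (A k)` with `|B|` and with
`|Bᴴ|` by `N S` each; these two bounds make the constant `2`. Each `Re tr (B * A k)` is controlled
by the same pairings through `Matrix.two_mul_re_trace_mul_le_abs`, a Frobenius AM-GM applied to
polar factors split into square roots. For sharpness, the symmetric modulus of `E₁₂` is `(E₁₁ + E₂₂)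
/ 2`, of operator norm `1 / 2`. -/

/-- Every seminorm is attained at a given point by a linear functional that it dominates. -/
theorem Seminorm.exists_linearMap_apply_eq {E : Type*} [AddCommGroup E] [Module ℂ E]
    (N : Seminorm ℂ E) (x : E) :
    ∃ f : E →ₗ[ℂ] ℂ, f x = (N x : ℂ) ∧ ∀ y, ‖f y‖ ≤ N y := by
  let _ : SeminormedAddCommGroup E := N.toAddGroupSeminorm.toSeminormedAddCommGroup
  have hn : ∀ y : E, ‖y‖ = N y := fun _ => rfl
  let _ : NormedSpace ℂ E := ⟨fun a b => by rw [hn, hn, map_smul_eq_mul]⟩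
  obtain ⟨g, hg, hgx⟩ := exists_dual_vector'' ℂ x
  exact ⟨g, hgx, fun y => (g.le_of_opNorm_le hg y).trans_eq (by rw [one_mul, hn])⟩

/-- Every linear functional on matrices is of the form `Z ↦ tr (B * Z)`. -/
theorem Matrix.exists_eq_trace_mul {n : ℕ} (f : Matrix (Fin n) (Fin n) ℂ →ₗ[ℂ] ℂ) :
    ∃ B : Matrix (Fin n) (Fin n) ℂ, ∀ Z, f Z = (B * Z).trace := by
  refine ⟨Matrix.of fun j i => f (Matrix.single i j 1), fun Z => ?_⟩
  conv_lhs => rw [Matrix.matrix_eq_sum_single Z]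
  simp only [map_sum, Matrix.trace, Matrix.diag, Matrix.mul_apply, Matrix.of_apply]
  rw [Finset.sum_comm]
  refine Finset.sum_congr rfl fun j _ => Finset.sum_congr rfl fun i _ => ?_
  rw [← mul_one (Z i j), ← smul_eq_mul (Z i j), ← Matrix.smul_single, map_smul, smul_eq_mul,
    smul_eq_mul, mul_one, mul_comm]

/-- Two operators with the same pointwise norms differ by a linear isometry. -/
theorem LinearMap.exists_linearIsometry_comp_eq {V : Type*} [NormedAddCommGroup V]
    [InnerProductSpace ℂ V] [FiniteDimensional ℂ V] (S T : V →ₗ[ℂ] V)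
    (h : ∀ x, ‖S x‖ = ‖T x‖) : ∃ U : V →ₗᵢ[ℂ] V, ∀ x, S x = U (T x) := by
  -- With `g` a linear section of `T`, the map `S ∘ g` is isometric on the range of `T`; finite
  -- dimension lets it extend to all of `V`.
  obtain ⟨g, hg⟩ := T.rangeRestrict.exists_rightInverse_of_surjective T.range_rangeRestrict
  have hg' : ∀ y : LinearMap.range T, T (g y) = y := fun y =>
    congrArg Subtype.val (LinearMap.congr_fun hg y)
  let L : LinearMap.range T →ₗᵢ[ℂ] V :=
    ⟨S ∘ₗ g, fun y => by rw [LinearMap.comp_apply, h, hg']; rfl⟩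
  refine ⟨L.extend, fun x => ?_⟩
  have h1 := L.extend_apply (T.rangeRestrict x)
  have h2 : L (T.rangeRestrict x) = S (g (T.rangeRestrict x)) := rfl
  rw [h2] at h1
  refine Eq.trans ?_ h1.symm
  rw [← sub_eq_zero, ← map_sub, ← norm_eq_zero, h, map_sub, hg']
  simp

open scoped InnerProductSpace in
/-- Polar decomposition of a square matrix with a unitary factor. -/
theorem Matrix.exists_unitary_mul_abs_eq {n : ℕ} (B : Matrix (Fin n) (Fin n) ℂ) :
    ∃ W ∈ Matrix.unitaryGroup (Fin n) ℂ, B = W * CFC.abs B := by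
  have hsa : star (CFC.abs B) = CFC.abs B := (CFC.abs_nonneg B).isSelfAdjoint.star_eq
  -- The norm of `C x` depends only on `star C * C`, which is the same for `B` and `|B|`.
  have key : ∀ (C : Matrix (Fin n) (Fin n) ℂ) (x : EuclideanSpace ℂ (Fin n)),
      ‖Matrix.toEuclideanCLM (n := Fin n) (𝕜 := ℂ) C x‖ ^ 2 =
        RCLike.re ⟪x, Matrix.toEuclideanCLM (n := Fin n) (𝕜 := ℂ) (star C * C) x⟫_ℂ := by
    intro C x
    rw [map_mul, map_star, ContinuousLinearMap.star_eq_adjoint, mul_apply_eq_comp,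
      ContinuousLinearMap.adjoint_inner_right, inner_self_eq_norm_sq]
  obtain ⟨U, hU⟩ := LinearMap.exists_linearIsometry_comp_eq (V := EuclideanSpace ℂ (Fin n))
    (Matrix.toEuclideanCLM (n := Fin n) (𝕜 := ℂ) B).toLinearMap
    (Matrix.toEuclideanCLM (n := Fin n) (𝕜 := ℂ) (CFC.abs B)).toLinearMap (fun x => by
      refine (sq_eq_sq₀ (norm_nonneg _) (norm_nonneg _)).1 ?_
      simp only [ContinuousLinearMap.coe_coe]
      rw [key, key, hsa, CFC.abs_mul_abs])
  have hinj : Function.Injective (Matrix.toEuclideanCLM (n := Fin n) (𝕜 := ℂ)) :=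
    EquivLike.injective _
  obtain ⟨W, hW⟩ := EquivLike.surjective (Matrix.toEuclideanCLM (n := Fin n) (𝕜 := ℂ))
    U.toContinuousLinearMap
  refine ⟨W, Matrix.mem_unitaryGroup_iff'.2 (hinj ?_), hinj ?_⟩
  · rw [map_mul, map_star, map_one, hW, ContinuousLinearMap.star_eq_adjoint]
    exact (ContinuousLinearMap.norm_map_iff_adjoint_comp_self _).1 U.norm_map
  · rw [map_mul, hW]
    ext1 x
    exact hU x

/-- If `B = W * |B|` with `W` unitary then `|Bᴴ| = W * |B| * Wᴴ`. -/
theorem Matrix.abs_conjTranspose_eq {n : ℕ} {B W : Matrix (Fin n) (Fin n) ℂ}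
    (hW : W ∈ Matrix.unitaryGroup (Fin n) ℂ) (h : B = W * CFC.abs B) :
    CFC.abs Bᴴ = W * CFC.abs B * star W := by
  have hsa : star (CFC.abs B) = CFC.abs B := (CFC.abs_nonneg B).isSelfAdjoint.star_eq
  have h2 : B * star B = W * (CFC.abs B * CFC.abs B) * star W := by
    conv_lhs => rw [h]
    rw [star_mul, hsa]
    simp only [mul_assoc]
  refine CFC.sqrt_unique ?_ (star_right_conjugate_nonneg (CFC.abs_nonneg B) W)
  rw [← Matrix.star_eq_conjTranspose, star_star, h2]
  calc W * CFC.abs B * star W * (W * CFC.abs B * star W)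
      = W * CFC.abs B * (star W * W) * CFC.abs B * star W := by simp only [mul_assoc]
    _ = _ := by rw [Matrix.mem_unitaryGroup_iff'.1 hW, mul_one]; simp only [mul_assoc]

open scoped ComplexOrder in
theorem Matrix.re_trace_nonneg {n : ℕ} {P : Matrix (Fin n) (Fin n) ℂ} (hP : 0 ≤ P) :
    0 ≤ P.trace.re :=
  (RCLike.nonneg_iff.1 (Matrix.nonneg_iff_posSemidef.1 hP).trace_nonneg).1

/-- By cyclicity the trace is that of the positive matrix `√P * Q * √P`. -/
theorem Matrix.re_trace_mul_nonneg {n : ℕ} {P Q : Matrix (Fin n) (Fin n) ℂ}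
    (hP : 0 ≤ P) (hQ : 0 ≤ Q) : 0 ≤ (P * Q).trace.re := by
  have h : (P * Q).trace = (star (CFC.sqrt P) * Q * CFC.sqrt P).trace := by
    rw [(CFC.sqrt_nonneg P).isSelfAdjoint.star_eq, Matrix.trace_mul_comm (_ * Q), ← mul_assoc,
      CFC.sqrt_mul_sqrt_self P hP]
  rw [h]
  exact Matrix.re_trace_nonneg (star_left_conjugate_nonneg hQ (CFC.sqrt P))

/-- The inequality of arithmetic and geometric means for the Frobenius inner product. -/
theorem Matrix.two_mul_re_trace_mul_le {n : ℕ} (X Y : Matrix (Fin n) (Fin n) ℂ) :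
    2 * (X * Y).trace.re ≤ (X * star X).trace.re + (star Y * Y).trace.re := by
  -- Expand the squared Frobenius norm of `X - star Y`.
  have h := Matrix.re_trace_nonneg (mul_star_self_nonneg (X - star Y))
  have h1 : (star Y * star X).trace.re = (X * Y).trace.re := by
    rw [← star_mul, Matrix.star_eq_conjTranspose, Matrix.trace_conjTranspose]
    simp
  rw [star_sub, star_star, sub_mul, mul_sub, mul_sub, Matrix.trace_sub, Matrix.trace_sub,
    Matrix.trace_sub] at h
  simp only [Complex.sub_re, h1] at h
  linarith

/-- The trace pairing of two matrices is bounded by the trace pairings of their moduli. -/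
theorem Matrix.two_mul_re_trace_mul_le_abs {n : ℕ} (B Z : Matrix (Fin n) (Fin n) ℂ) :
    2 * (B * Z).trace.re ≤
      (CFC.abs Z * CFC.abs Bᴴ).trace.re + (CFC.abs Zᴴ * CFC.abs B).trace.re := by
  obtain ⟨W, hW, hB⟩ := Matrix.exists_unitary_mul_abs_eq B
  obtain ⟨V, hV, hZ⟩ := Matrix.exists_unitary_mul_abs_eq Z
  rw [Matrix.abs_conjTranspose_eq hW hB, Matrix.abs_conjTranspose_eq hV hZ]
  set P := CFC.abs Z
  set Q := CFC.abs B
  have hP : CFC.sqrt P * CFC.sqrt P = P := CFC.sqrt_mul_sqrt_self P (CFC.abs_nonneg Z)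
  have hQ : CFC.sqrt Q * CFC.sqrt Q = Q := CFC.sqrt_mul_sqrt_self Q (CFC.abs_nonneg B)
  have hPs : star (CFC.sqrt P) = CFC.sqrt P := (CFC.sqrt_nonneg P).isSelfAdjoint.star_eq
  have hQs : star (CFC.sqrt Q) = CFC.sqrt Q := (CFC.sqrt_nonneg Q).isSelfAdjoint.star_eq
  -- Each factor takes a square root of both moduli, so the product recovers `tr (B * Z)` while each
  -- square pairs one modulus with a conjugated one.
  have h := Matrix.two_mul_re_trace_mul_le (CFC.sqrt P * W * CFC.sqrt Q)
    (CFC.sqrt Q * V * CFC.sqrt P)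
  have e1 : (CFC.sqrt P * W * CFC.sqrt Q * (CFC.sqrt Q * V * CFC.sqrt P)).trace =
      (B * Z).trace := by
    rw [hB, hZ, Matrix.trace_mul_comm, ← mul_assoc, Matrix.trace_mul_comm]
    rw [show CFC.sqrt Q * (CFC.sqrt Q * V * CFC.sqrt P * (CFC.sqrt P * W)) =
      (CFC.sqrt Q * CFC.sqrt Q) * V * (CFC.sqrt P * CFC.sqrt P) * W by simp only [mul_assoc],
      hP, hQ, Matrix.trace_mul_comm]
    simp only [mul_assoc]
  have e2 : (CFC.sqrt P * W * CFC.sqrt Q * star (CFC.sqrt P * W * CFC.sqrt Q)).trace =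
      (P * (W * Q * star W)).trace := by
    rw [star_mul, star_mul, hPs, hQs, ← mul_assoc, ← mul_assoc, Matrix.trace_mul_comm]
    conv_rhs => rw [← hP, ← hQ]
    simp only [mul_assoc]
  have e3 : (star (CFC.sqrt Q * V * CFC.sqrt P) * (CFC.sqrt Q * V * CFC.sqrt P)).trace =
      (V * P * star V * Q).trace := by
    rw [star_mul, star_mul, hPs, hQs, Matrix.trace_mul_comm,
      show CFC.sqrt Q * V * CFC.sqrt P * (CFC.sqrt P * (star V * CFC.sqrt Q)) =
        CFC.sqrt Q * (V * (CFC.sqrt P * CFC.sqrt P) * star V * CFC.sqrt Q) by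
          simp only [mul_assoc],
      hP, Matrix.trace_mul_comm, mul_assoc, hQ]
  rw [e1, e2, e3] at h
  exact h

/-- Every unitarily invariant norm satisfies the matrix triangle inequality with constant `2` for
the arithmetic symmetric modulus. -/
theorem IsUnitarilyInvariantNorm.apply_sum_le {n m : ℕ}
    {N : Seminorm ℂ (Matrix (Fin n) (Fin n) ℂ)} (hN : IsUnitarilyInvariantNorm N)
    (A : Fin m → Matrix (Fin n) (Fin n) ℂ) :
    N (∑ k, A k) ≤ 2 * N (∑ k, symModulus (A k)) := by
  obtain ⟨f, hf, hfN⟩ := N.exists_linearMap_apply_eq (∑ k, A k)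
  obtain ⟨B, hB⟩ := Matrix.exists_eq_trace_mul f
  obtain ⟨W, hW, hBW⟩ := Matrix.exists_unitary_mul_abs_eq B
  have hWW : star W * W = 1 := Matrix.mem_unitaryGroup_iff'.1 hW
  have hW' : star W ∈ Matrix.unitaryGroup (Fin n) ℂ := Unitary.star_mem hW
  have hone : (1 : Matrix (Fin n) (Fin n) ℂ) ∈ Matrix.unitaryGroup (Fin n) ℂ := one_mem _
  have habs : star W * B = CFC.abs B := by
    conv_lhs => rw [hBW]
    rw [← mul_assoc, hWW, one_mul]
  have habs' : B * star W = CFC.abs Bᴴ := by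
    rw [Matrix.abs_conjTranspose_eq hW hBW, ← hBW]
  set S := ∑ k, symModulus (A k) with hS
  have hre : ∀ Z, (B * Z).trace.re ≤ N Z := fun Z => by
    rw [← hB]
    exact (Complex.re_le_norm _).trans (hfN Z)
  have h1 : (S * CFC.abs B).trace.re ≤ N S := by
    have h := hre (1 * S * star W)
    rw [hN.unitary_mul_mul_unitary 1 hone _ hW', one_mul, ← mul_assoc, Matrix.trace_mul_comm,
      ← mul_assoc, habs, Matrix.trace_mul_comm] at h
    exact h
  have h2 : (S * CFC.abs Bᴴ).trace.re ≤ N S := by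
    have h := hre (star W * S * 1)
    rw [hN.unitary_mul_mul_unitary _ hW' 1 hone, mul_one, ← mul_assoc, habs',
      Matrix.trace_mul_comm] at h
    exact h
  have h3 : ∀ k, (B * A k).trace.re ≤ (symModulus (A k) * CFC.abs Bᴴ).trace.re +
      (symModulus (A k) * CFC.abs B).trace.re := fun k => by
    have h := Matrix.two_mul_re_trace_mul_le_abs B (A k)
    -- These two cross terms are absent from `h` but occur on the right-hand side; being
    -- nonnegative, they may be added.
    have ha := Matrix.re_trace_mul_nonneg (CFC.abs_nonneg (A k)) (CFC.abs_nonneg B)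
    have hb := Matrix.re_trace_mul_nonneg (CFC.abs_nonneg (A k)ᴴ) (CFC.abs_nonneg Bᴴ)
    simp only [symModulus, Matrix.smul_mul, add_mul, Matrix.trace_smul, Matrix.trace_add,
      Complex.smul_re, Complex.add_re, smul_eq_mul]
    linarith
  have h4 : N (∑ k, A k) = ∑ k, (B * A k).trace.re := by
    rw [← Complex.ofReal_re (N _), ← hf, hB, Finset.mul_sum, Matrix.trace_sum, Complex.re_sum]
  have h5 : ∀ C : Matrix (Fin n) (Fin n) ℂ,
      ∑ k, (symModulus (A k) * C).trace.re = (S * C).trace.re := fun C => by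
    rw [hS, Finset.sum_mul, Matrix.trace_sum, Complex.re_sum]
  rw [h4]
  refine (Finset.sum_le_sum fun k _ => h3 k).trans ?_
  rw [Finset.sum_add_distrib, h5, h5]
  linarith

/-- The operator norm as a seminorm on matrices. -/
noncomputable def matrixOpSeminorm (n : ℕ) : Seminorm ℂ (Matrix (Fin n) (Fin n) ℂ) :=
  (normSeminorm ℂ (EuclideanSpace ℂ (Fin n) →L[ℂ] EuclideanSpace ℂ (Fin n))).comp
    (Matrix.toEuclideanCLM (n := Fin n) (𝕜 := ℂ)).toAlgEquiv.toLinearMap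

theorem matrixOpSeminorm_apply {n : ℕ} (Z : Matrix (Fin n) (Fin n) ℂ) :
    matrixOpSeminorm n Z = matrixOpNorm Z := rfl

theorem isUnitarilyInvariantNorm_matrixOpSeminorm (n : ℕ) :
    IsUnitarilyInvariantNorm (matrixOpSeminorm n) where
  eq_zero_of_apply_eq_zero Z h := by
    rw [matrixOpSeminorm_apply, matrixOpNorm, norm_eq_zero] at h
    exact (map_eq_zero_iff _ (Matrix.toEuclideanCLM (n := Fin n) (𝕜 := ℂ)).injective).1 h
  unitary_mul_mul_unitary U hU V hV Z := by
    rw [matrixOpSeminorm_apply, matrixOpSeminorm_apply, matrixOpNorm, matrixOpNorm, map_mul,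
      map_mul, CStarRing.norm_mul_mem_unitary _ (Unitary.map_mem _ hV),
      CStarRing.norm_mem_unitary_mul _ (Unitary.map_mem _ hU)]

open scoped Matrix.Norms.L2Operator in
theorem matrixOpNorm_diagonal {n : ℕ} (v : Fin n → ℂ) :
    matrixOpNorm (Matrix.diagonal v) = ‖v‖ :=
  Matrix.l2_opNorm_diagonal v

theorem matrixOpNorm_smul {n : ℕ} (c : ℂ) (Z : Matrix (Fin n) (Fin n) ℂ) :
    matrixOpNorm (c • Z) = ‖c‖ * matrixOpNorm Z :=
  map_smul_eq_mul (matrixOpSeminorm n) c Z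

theorem abs_matrix_single {n : ℕ} (i j : Fin n) :
    CFC.abs (Matrix.single i j (1 : ℂ)) = Matrix.single j j 1 := by
  refine CFC.sqrt_unique ?_ ?_
  · simp [Matrix.star_eq_conjTranspose]
  · have h := star_mul_self_nonneg (Matrix.single i j (1 : ℂ))
    simpa [Matrix.star_eq_conjTranspose] using h

open scoped Matrix.Norms.L2Operator in
theorem matrixOpNorm_single {n : ℕ} (i j : Fin n) :
    matrixOpNorm (Matrix.single i j (1 : ℂ)) = 1 := by
  have h := Matrix.l2_opNorm_conjTranspose_mul_self (Matrix.single i j (1 : ℂ))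
  have h2 : matrixOpNorm (Matrix.single j j (1 : ℂ)) = 1 := by
    rw [← Matrix.diagonal_single, matrixOpNorm_diagonal, Pi.norm_single, norm_one]
  have h3 : ‖Matrix.single j j (1 : ℂ)‖ = 1 := h2
  simp only [Matrix.conjTranspose_single, Matrix.single_mul_single_same, star_one, mul_one,
    h3] at h
  change ‖Matrix.single i j (1 : ℂ)‖ = 1
  -- The C*-identity gives `‖E_ij‖ ^ 2 = ‖E_jj‖ = 1`.
  nlinarith [norm_nonneg (Matrix.single i j (1 : ℂ))]

theorem matrixOpNorm_symModulus_single {n : ℕ} {i j : Fin n} (hij : i ≠ j) :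
    matrixOpNorm (symModulus (Matrix.single i j (1 : ℂ))) = 1 / 2 := by
  have h : symModulus (Matrix.single i j (1 : ℂ)) =
      (1 / 2 : ℂ) • Matrix.diagonal (Pi.single j (1 : ℂ) + Pi.single i 1) := by
    rw [symModulus, Matrix.conjTranspose_single, star_one, abs_matrix_single, abs_matrix_single,
      ← Matrix.diagonal_single, ← Matrix.diagonal_single, Matrix.diagonal_add]
    ext a b
    simp [Matrix.smul_apply, Matrix.diagonal_apply, mul_add]
  have h2 : ‖(Pi.single j 1 + Pi.single i 1 : Fin n → ℂ)‖ = 1 := by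
    refine le_antisymm ((pi_norm_le_iff_of_nonneg zero_le_one).2 fun a => ?_) ?_
    · by_cases ha : a = j
      · subst ha; simp [hij.symm]
      · by_cases hb : a = i
        · subst hb; simp [ha]
        · simp [ha, hb]
    · have h := norm_le_pi_norm (Pi.single j 1 + Pi.single i 1 : Fin n → ℂ) j
      rwa [Pi.add_apply, Pi.single_eq_same, Pi.single_eq_of_ne hij.symm, add_zero,
        norm_one] at h
  rw [h, matrixOpNorm_smul, matrixOpNorm_diagonal, h2]
  norm_num

theorem mainTheorem5 (m n : ℕ) :
    (∀ N : Seminorm ℂ (Matrix (Fin n) (Fin n) ℂ), IsUnitarilyInvariantNorm N →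
      ∀ A : Fin m → Matrix (Fin n) (Fin n) ℂ,
        N (∑ k, A k) ≤ 2 * N (∑ k, symModulus (A k))) ∧
    (∀ (_ : 1 ≤ m) (hn : 2 ≤ n),
      IsLeast {C : ℝ | ∀ N : Seminorm ℂ (Matrix (Fin n) (Fin n) ℂ), IsUnitarilyInvariantNorm N →
        ∀ A : Fin m → Matrix (Fin n) (Fin n) ℂ,
          N (∑ k, A k) ≤ C * N (∑ k, symModulus (A k))} 2 ∧
      ∀ A : Fin m → Matrix (Fin n) (Fin n) ℂ,
        (∀ k, A k = Matrix.single ⟨0, by omega⟩ ⟨1, by omega⟩ 1) →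
          0 < matrixOpNorm (∑ k, symModulus (A k)) ∧
          matrixOpNorm (∑ k, A k) = 2 * matrixOpNorm (∑ k, symModulus (A k))) := by
  refine ⟨fun N hN A => hN.apply_sum_le A, fun hm hn => ?_⟩
  have hext : ∀ A : Fin m → Matrix (Fin n) (Fin n) ℂ,
      (∀ k, A k = Matrix.single ⟨0, by omega⟩ ⟨1, by omega⟩ 1) →
        0 < matrixOpNorm (∑ k, symModulus (A k)) ∧
        matrixOpNorm (∑ k, A k) = 2 * matrixOpNorm (∑ k, symModulus (A k)) := by
    intro A hA
    have hm' : (0 : ℝ) < m := by exact_mod_cast hm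
    have hij : (⟨0, by omega⟩ : Fin n) ≠ ⟨1, by omega⟩ := by simp
    simp only [hA, Finset.sum_const, Finset.card_univ, Fintype.card_fin, ← Nat.cast_smul_eq_nsmul ℂ,
      matrixOpNorm_smul, matrixOpNorm_single, matrixOpNorm_symModulus_single hij,
      Complex.norm_natCast]
    constructor
    · positivity
    · ring
  refine ⟨⟨fun N hN A => hN.apply_sum_le A, fun C hC => ?_⟩, hext⟩
  obtain ⟨hpos, heq⟩ := hext (fun _ => Matrix.single ⟨0, by omega⟩ ⟨1, by omega⟩ 1) fun _ => rfl
  have h := hC _ (isUnitarilyInvariantNorm_matrixOpSeminorm n)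
    (fun _ => Matrix.single ⟨0, by omega⟩ ⟨1, by omega⟩ 1)
  rw [matrixOpSeminorm_apply, matrixOpSeminorm_apply, heq] at h
  exact le_of_mul_le_mul_right h hpos
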